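/- Let $n\ge 1$, $\sigma^*>0$, $\delta\in(0,1)$, $f^*\in\mathbb R^n$ and $y=f^*+\xi$, where $\xi_1,\dots,\xi_n$ are i.i.d. $\mathcal N(0,\sigma^{*2})$. For $f\in\mathbb R^n$ put $f_0=0$, $\|f\|_{\rm TV}=\sum_{j=1}^n|f_j-f_{j-1}|$ and, for $T\subset\{1,\dots,n\}$ with complement $T^c$, $\|f_{T^c}\|_{\rm TV}=\sum_{j\in T^c}|f_j-f_{j-1}|$. Let $\Delta_{\min,T}$ be the smallest distance between two distinct elements of $T\cup\{1,n+1\}$. Set $$\lambda=2\sigma^*\sqrt{\frac{2\log(n/\delta)}{n}} .$$ Let $\widehat f$ be the TV-penalized least-squares estimator, i.e. a minimizer over $f\in\mathbb R^n$ of $\frac1n\|y-f\|_2^2+\lambda\|f\|_{\rm TV}$, or, alternatively, the Lasso fit $\widehat f=X\widehat\beta$ with design $X=(\mathbf 1(i\ge j))_{1\le i,j\le n}$, where $\widehat\beta$ minimizes $\frac1{2n}\|y-X\beta\|_2^2+\lambda\|\beta\|_1$ over $\beta\in\mathbb R^n$. Then there is an event of probability at least $1-2\delta$ on which the following hold for both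 choices of $\widehat f$. 1. For every nonempty $T\subset\{1,\dots,n\}$, $$\frac1n\|\widehat f-f^*\|_2^2\le\inf_{\bar f\in\mathbb R^n}\Big\{\frac1n\|\bar f-f^*\|_2^2+4\lambda\|\bar f_{T^c}\|_{\rm TV}\Big\}+\frac{4\sigma^{*2}|T|\log(n/\delta)}{n}\Big(3+256\Big(\log n+\frac{n}{\Delta_{\min,T}}\Big)\Big).$$ 2. If the jump set $J^*=\{j\in\{1,\dots,n\}: f^*_j\ne f^*_{j-1}\}$ (with $f^*_0=0$) is nonempty, then $$\frac1n\|\widehat f-f^*\|_2^2\le\frac{4\sigma^{*2}|J^*|\log(n/\delta)}{n}\Big(3+256\Big(\log n+\frac{n}{\Delta_{\min,J^*}}\Big)\Big).$$ 3. If moreover $n\ge2$ and $n/\Delta_{\min,J^*}\le K$, then $$\frac1n\|\widehat f-f^*\|_2^2\le C(\delta,K)\,\frac{\sigma^{*2}|J^*|\log^2 n}{n},$$ where the constant $C(\delta,K)$ depends only on $\delta$ and $K$. -/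

import Mathlib

open MeasureTheory ProbabilityTheory

namespace TVDenoise

noncomputable section

/-- The squared Euclidean norm of a vector. -/
def sqNorm {n : ℕ} (v : Fin n → ℝ) : ℝ := ∑ i, v i ^ 2

/-- The vector of increments, with the convention that the entry preceding the first one is `0`.
Entries are indexed by `Fin n`, so that `i : Fin n` stands for the index `i + 1` of `{1, …, n}`. -/
def incr {n : ℕ} (f : Fin n → ℝ) : Fin n → ℝ := fun j =>
  f j - (if (j : ℕ) = 0 then 0 else f ⟨(j : ℕ) - 1, lt_of_le_of_lt (Nat.sub_le _ _) j.isLt⟩)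

/-- The sum of the absolute increments of `f` at the positions of `S`. -/
def tvOn {n : ℕ} (S : Finset (Fin n)) (f : Fin n → ℝ) : ℝ := ∑ j ∈ S, |incr f j|

/-- The total variation of `f` (with `f_0 = 0`). -/
def tv {n : ℕ} (f : Fin n → ℝ) : ℝ := tvOn Finset.univ f

/-- `f` is a TV-penalized least-squares estimator for the data `y`:
a minimizer of `(1/n) ‖y - f‖² + lam * ‖f‖_TV`. -/
def IsTVEstimator {n : ℕ} (lam : ℝ) (y f : Fin n → ℝ) : Prop :=
  ∀ g : Fin n → ℝ,
    1 / (n : ℝ) * sqNorm (y - f) + lam * tv f ≤ 1 / (n : ℝ) * sqNorm (y - g) + lam * tv g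

/-- `b` is a Lasso estimator for the data `y` and the design `X`:
a minimizer of `(1/(2n)) ‖y - X b‖² + lam * ‖b‖₁`. -/
def IsLasso {n p : ℕ} (X : Matrix (Fin n) (Fin p) ℝ) (lam : ℝ) (y : Fin n → ℝ)
    (b : Fin p → ℝ) : Prop :=
  ∀ c : Fin p → ℝ,
    1 / (2 * (n : ℝ)) * sqNorm (y - X.mulVec b) + lam * ∑ j, |b j| ≤
      1 / (2 * (n : ℝ)) * sqNorm (y - X.mulVec c) + lam * ∑ j, |c j|

/-- The lower-triangular all-ones design. -/
def tvDesign (n : ℕ) : Matrix (Fin n) (Fin n) ℝ :=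
  Matrix.of fun i j => if j ≤ i then 1 else 0

/-- `T` as a subset of `{1, …, n}`, together with the two end points `1` and `n + 1`. -/
def breakpoints {n : ℕ} (T : Finset (Fin n)) : Finset ℕ :=
  insert 1 (insert (n + 1) (T.image fun i : Fin n => (i : ℕ) + 1))

/-- The smallest distance between two distinct elements of `T ∪ {1, n + 1}`, that is, the length of
the shortest (nonempty) interval of the partition of `{1, …, n}` induced by `T`. -/
def minGap {n : ℕ} (T : Finset (Fin n)) : ℕ :=
  sInf {d : ℕ | ∃ a ∈ breakpoints T, ∃ b ∈ breakpoints T, a < b ∧ d = b - a}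

/-- The set of jumps `{j : f_j ≠ f_{j-1}}`, with `f_0 = 0`. -/
def jumps {n : ℕ} (f : Fin n → ℝ) : Finset (Fin n) := {j | incr f j ≠ 0}

/-- The bound `(4 σ² |T| log(n/δ) / n) * (3 + 256 (log n + n / Δ_{min,T}))`. -/
def remainder {n : ℕ} (s δ : ℝ) (T : Finset (Fin n)) : ℝ :=
  4 * s ^ 2 * (T.card : ℝ) * Real.log (n / δ) / n *
    (3 + 256 * (Real.log n + (n : ℝ) / (minGap T : ℝ)))

end

end TVDenoise

namespace TVDenoise

/-! The only probabilistic input is a union bound over intervals: off an event of probability at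
most 2δ, every noise sum over an interval of length ℓ is at most M√ℓ, with M = s√(4 log(n/δ)).
Everything else is deterministic, hence uniform in `T` and in the comparison vector.

Let h = f̂ - g, with increments β. Convexity gives a basic inequality with an extra ‖h‖²/n on the
left (`IsTVEstimator.basic_inequality`); spending it on the noise is what makes the oracle
inequality sharp. What has to be bounded is 2⟨ξ, h⟩ plus the penalty, which enters with a plus sign
on `T` and a minus sign off `T`.

Split the partial sums of ξ into their linear interpolant at the break points and a bridge E
vanishing there (`exists_interpolation`). The slopes have squared norm at most M²(|T| + 1).
Summation by parts turns the bridge into -2∑ E_j β_j, which the negative penalty off `T` can pay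
for. What is left is at most 2ν∑ q_j β_j as soon as q is the sign of β on `T` and |q_j| ≤ 1 -
|E_j|/ν off `T`. Such a q is a sum of disjoint bumps (`certificate`): since |E_j| grows at most like
the square root of the distance to a break point, a square-root cusp leaves enough room. Summing by
parts back, completing the square against ‖h‖² and using ∑ (q_j - q_{j+1})² ≲ |T| (log n / n + 1/Δ)
gives `noise_add_penalty_le`. -/

/-! ### Gaussian tails and the uniform control of interval sums -/

theorem hasSubgaussianMGF_of_hasLaw_gaussianReal {Ω : Type*} [MeasurableSpace Ω] {P : Measure Ω}
    {X : Ω → ℝ} {v : NNReal} (hX : HasLaw X (gaussianReal 0 v) P) :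
    HasSubgaussianMGF X v P := by
  have h : HasSubgaussianMGF id v (P.map X) := by
    rw [hX.map_eq]
    refine ⟨fun t => integrable_exp_mul_gaussianReal t, fun t => ?_⟩
    rw [mgf_id_gaussianReal]
    simp
  simpa using HasSubgaussianMGF.of_map hX.aemeasurable h

/-- The two-sided Gaussian tail bound for a sum of independent centred normal variables. -/
theorem measure_lt_abs_sum_gaussian_le {ι Ω : Type*} [MeasurableSpace Ω] {P : Measure Ω}
    [IsProbabilityMeasure P] {ξ : ι → Ω → ℝ} {v : NNReal}
    (hlaw : ∀ i, HasLaw (ξ i) (gaussianReal 0 v) P) (hind : iIndepFun ξ P)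
    (S : Finset ι) {ε : ℝ} (hε : 0 ≤ ε) :
    P {ω | ε < |∑ i ∈ S, ξ i ω|} ≤
      ENNReal.ofReal (2 * Real.exp (-ε ^ 2 / (2 * (S.card * v)))) := by
  have hsub : ∀ i ∈ S, HasSubgaussianMGF (ξ i) v P := fun i _ =>
    hasSubgaussianMGF_of_hasLaw_gaussianReal (hlaw i)
  have hsum := HasSubgaussianMGF.sum_of_iIndepFun hind hsub
  have h1 := hsum.measure_ge_le hε
  have h2 := hsum.neg.measure_ge_le hε
  have hc : ((∑ i ∈ S, v : NNReal) : ℝ) = S.card * v := by simp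
  rw [hc] at h1 h2
  rw [← ENNReal.ofReal_toReal (measure_ne_top P _)]
  apply ENNReal.ofReal_le_ofReal
  change P.real _ ≤ _
  calc P.real {ω | ε < |∑ i ∈ S, ξ i ω|}
      ≤ P.real ({ω | ε ≤ ∑ i ∈ S, ξ i ω} ∪ {ω | ε ≤ (-fun ω => ∑ i ∈ S, ξ i ω) ω}) := by
        apply measureReal_mono
        · intro ω hω
          rcases lt_abs.1 (show ε < |∑ i ∈ S, ξ i ω| from hω) with h | h
          · exact Or.inl h.le
          · exact Or.inr h.le
        · exact measure_ne_top P _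
    _ ≤ _ := (measureReal_union_le _ _).trans (by linarith)

/-- With probability at least `1 - 2 δ`, all partial sums over intervals are controlled. -/
theorem exists_event_interval_sums {n : ℕ} (hn : 1 ≤ n) {s δ : ℝ} (hs : 0 < s) (hδ0 : 0 < δ)
    (hδ1 : δ < 1) {Ω : Type*} [MeasurableSpace Ω] (P : Measure Ω) [IsProbabilityMeasure P]
    (ξ : Fin n → Ω → ℝ) (hlaw : ∀ i, HasLaw (ξ i) (gaussianReal 0 (s ^ 2).toNNReal) P)
    (hind : iIndepFun ξ P) :
    ∃ A : Set Ω, MeasurableSet A ∧ ENNReal.ofReal (1 - 2 * δ) ≤ P A ∧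
      ∀ ω ∈ A, ∀ a b : Fin n, |∑ i ∈ Finset.Icc a b, ξ i ω| ≤
        s * √(4 * Real.log (n / δ)) * √((Finset.Icc a b).card) := by
  have hn' : (1 : ℝ) ≤ n := by exact_mod_cast hn
  have hL : 0 < Real.log (n / δ) := Real.log_pos (by rw [lt_div_iff₀ hδ0]; linarith)
  set L := Real.log (n / δ) with hLdef
  let bad : Fin n × Fin n → Set Ω := fun p =>
    {ω | s * √(4 * L) * √((Finset.Icc p.1 p.2).card) < |∑ i ∈ Finset.Icc p.1 p.2, ξ i ω|}
  have hbad : ∀ p, P (bad p) ≤ ENNReal.ofReal (2 * (δ / n) ^ 2) := by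
    intro p
    by_cases hc : (Finset.Icc p.1 p.2).card = 0
    · have : bad p = ∅ := by
        ext ω
        simp only [bad, Finset.card_eq_zero.1 hc, Set.mem_ofPred_eq, Finset.sum_empty, abs_zero,
          Set.mem_empty_iff_false, iff_false, not_lt]
        positivity
      simp [this]
    have hc' : (0 : ℝ) < (Finset.Icc p.1 p.2).card := by
      exact_mod_cast Nat.pos_of_ne_zero hc
    refine (measure_lt_abs_sum_gaussian_le hlaw hind _ (by positivity)).trans ?_
    apply ENNReal.ofReal_le_ofReal
    -- The threshold makes the exponent -2 log(n/δ), so each interval fails with probability at most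
    -- 2(δ/n)². The n² pairs of end points then cost 2δ² ≤ 2δ.
    have e : -(s * √(4 * L) * √((Finset.Icc p.1 p.2).card)) ^ 2 /
        (2 * ((Finset.Icc p.1 p.2).card * ((s ^ 2).toNNReal : ℝ))) = -L + -L := by
      rw [Real.coe_toNNReal _ (by positivity), mul_pow, mul_pow, Real.sq_sqrt (by positivity),
        Real.sq_sqrt (by positivity)]
      field_simp
      ring
    rw [e, Real.exp_add, hLdef, Real.exp_neg, Real.exp_log (by positivity), inv_div, pow_two]
  have hU : P (⋃ p, bad p) ≤ ENNReal.ofReal (2 * δ) := by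
    calc P (⋃ p, bad p) ≤ ∑ p, P (bad p) := measure_iUnion_fintype_le _ _
      _ ≤ ∑ _p : Fin n × Fin n, ENNReal.ofReal (2 * (δ / n) ^ 2) :=
          Finset.sum_le_sum fun p _ => hbad p
      _ = ENNReal.ofReal ((n * n : ℕ) * (2 * (δ / n) ^ 2)) := by
          rw [Finset.sum_const, nsmul_eq_mul,
            ENNReal.ofReal_mul (p := ((n * n : ℕ) : ℝ)) (by positivity), ENNReal.ofReal_natCast]
          simp
      _ ≤ ENNReal.ofReal (2 * δ) := by
          apply ENNReal.ofReal_le_ofReal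
          push_cast
          have : (n : ℝ) * n * (2 * (δ / n) ^ 2) = 2 * (δ * δ) := by field_simp
          rw [this]
          nlinarith
  -- The noise variables are only almost everywhere measurable, so the bad set is replaced by a
  -- measurable hull of the same measure.
  refine ⟨(toMeasurable P (⋃ p, bad p))ᶜ, (measurableSet_toMeasurable _ _).compl, ?_, ?_⟩
  · rw [prob_compl_eq_one_sub (measurableSet_toMeasurable _ _), measure_toMeasurable,
      ENNReal.ofReal_sub _ (by positivity), ENNReal.ofReal_one]
    exact tsub_le_tsub_left hU 1
  · intro ω hω a b
    by_contra hcon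
    exact hω (subset_toMeasurable _ _ (Set.mem_iUnion.2 ⟨(a, b), not_le.1 hcon⟩))

/-! ### Linear interpolation of the partial sums and the bridge remainder -/

/-- Every index below `n` lies in a block `[lo i, hi i)` cut out by the break points. -/
theorem exists_blocks {B : Finset ℕ} {n : ℕ} (h0 : 0 ∈ B) (hn : n ∈ B) :
    ∃ lo hi : ℕ → ℕ, ∀ i, i < n →
      lo i ∈ B ∧ hi i ∈ B ∧ lo i ≤ i ∧ i < hi i ∧ ∀ b ∈ B, b ≤ lo i ∨ hi i ≤ b := by
  have key : ∀ i, ∃ a b, i < n →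
      a ∈ B ∧ b ∈ B ∧ a ≤ i ∧ i < b ∧ ∀ c ∈ B, c ≤ a ∨ b ≤ c := by
    intro i
    by_cases hi : i < n
    · obtain ⟨a, ha, ha'⟩ := (B.filter (· ≤ i)).exists_max_image id
        ⟨0, Finset.mem_filter.2 ⟨h0, i.zero_le⟩⟩
      obtain ⟨b, hb, hb'⟩ := (B.filter (i < ·)).exists_min_image id
        ⟨n, Finset.mem_filter.2 ⟨hn, hi⟩⟩
      rw [Finset.mem_filter] at ha hb
      refine ⟨a, b, fun _ => ⟨ha.1, hb.1, ha.2, hb.2, fun c hc => ?_⟩⟩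
      rcases le_or_gt c i with h | h
      · exact Or.inl (ha' c (Finset.mem_filter.2 ⟨hc, h⟩))
      · exact Or.inr (hb' c (Finset.mem_filter.2 ⟨hc, h⟩))
    · exact ⟨0, 0, fun h => absurd h hi⟩
  choose lo hi h using key
  exact ⟨lo, hi, h⟩

/-- The bridge between two points, evaluated at distances `x²` and `y²` from them. -/
theorem bridge_weight_le {x y : ℝ} (hx : 0 ≤ x) (hy : 0 ≤ y) :
    (√2 * (y ^ 2 * x + x ^ 2 * y) ≤ (x ^ 2 + y ^ 2) * √(x ^ 2 + y ^ 2)) ∧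
      √2 * (y ^ 2 * x + x ^ 2 * y) ≤ (x ^ 2 + y ^ 2) * (2 * x) := by
  have h2 : √2 ^ 2 = 2 := Real.sq_sqrt (by norm_num)
  have h2p : 0 ≤ √2 := Real.sqrt_nonneg 2
  have hm := Real.sq_sqrt (show 0 ≤ x ^ 2 + y ^ 2 by positivity)
  have hmp := Real.sqrt_nonneg (x ^ 2 + y ^ 2)
  set r := √(x ^ 2 + y ^ 2)
  constructor
  · have hxy : x + y ≤ √2 * r := by
      apply le_of_sq_le_sq _ (by positivity)
      nlinarith [sq_nonneg (x - y)]
    have h1 : √2 * (x + y) ≤ 2 * r := by nlinarith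
    have h3 : 2 * (x * y) ≤ x ^ 2 + y ^ 2 := by nlinarith [sq_nonneg (x - y)]
    have : √2 * (y ^ 2 * x + x ^ 2 * y) = x * y * (√2 * (x + y)) := by ring
    rw [this]
    calc x * y * (√2 * (x + y)) ≤ x * y * (2 * r) := by gcongr
      _ = 2 * (x * y) * r := by ring
      _ ≤ _ := by gcongr
  · have h15 : √2 ≤ 3 / 2 := by
      rw [Real.sqrt_le_left (by norm_num)]; norm_num
    have : y ^ 2 + x * y ≤ 5 / 4 * (x ^ 2 + y ^ 2) := by nlinarith [sq_nonneg (x - y / 2)]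
    have h4 : √2 * (y ^ 2 + x * y) ≤ 2 * (x ^ 2 + y ^ 2) := by
      calc √2 * (y ^ 2 + x * y) ≤ 3 / 2 * (5 / 4 * (x ^ 2 + y ^ 2)) := by gcongr
        _ ≤ _ := by nlinarith [sq_nonneg x, sq_nonneg y]
    nlinarith

/-- If the increments of `Z` over intervals are controlled, then `Z` is the sum of its piecewise
linear interpolant at the break points, whose slopes `p` are square summable, and of a remainder
`E` that vanishes at the break points and is small next to them. -/
theorem exists_interpolation {B : Finset ℕ} {n : ℕ} (h0 : 0 ∈ B) (hn : n ∈ B) {M : ℝ} (hM : 0 ≤ M)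
    {Z : ℕ → ℝ} (hZ : ∀ a b, a < b → b ≤ n → |Z b - Z a| ≤ M * √((b : ℝ) - a)) :
    ∃ p E : ℕ → ℝ, (∀ i < n, Z (i + 1) - Z i = p i + (E (i + 1) - E i)) ∧
      (∀ b ∈ B, b ≤ n → E b = 0) ∧
      ∑ i ∈ Finset.range n, p i ^ 2 ≤ M ^ 2 * (B.erase n).card ∧
      ∀ j < n, √2 * |E j| ≤ M * √n ∧ ∀ t ∈ B, √2 * |E j| ≤ 2 * M * √|(j : ℝ) - t| := by
  obtain ⟨lo, hi, hb⟩ := exists_blocks h0 hn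
  have hin : ∀ i < n, hi i ≤ n := fun i hi' => by
    obtain ⟨_, _, h3, _, h5⟩ := hb i hi'
    rcases h5 n hn with h | h <;> omega
  -- `E` is `Z` minus the chord of its block, written through the increments from `j` to the two
  -- block ends so that `hZ` applies to each.
  let p : ℕ → ℝ := fun i => (Z (hi i) - Z (lo i)) / ((hi i : ℝ) - lo i)
  let E : ℕ → ℝ := fun j => if j < n then
    (((hi j : ℝ) - j) * (Z j - Z (lo j)) - ((j : ℝ) - lo j) * (Z (hi j) - Z j)) /
      ((hi j : ℝ) - lo j) else 0
  have hE0 : ∀ b ∈ B, b ≤ n → E b = 0 := by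
    intro b hbB hbn
    by_cases hlt : b < n
    · obtain ⟨_, _, h3, h4, h5⟩ := hb b hlt
      have : lo b = b := by rcases h5 b hbB with h | h <;> omega
      simp [E, this]
    · simp [E, hlt]
  refine ⟨p, E, ?_, hE0, ?_, ?_⟩
  · intro i hi'
    obtain ⟨h1, h2, h3, h4, h5⟩ := hb i hi'
    have hpos : (hi i : ℝ) - lo i ≠ 0 := by
      have : (lo i : ℝ) < hi i := by exact_mod_cast h3.trans_lt h4
      linarith
    -- Either the step ends at a break point, where the bridge is zero, or `i` and `i + 1` share a
    -- block and hence a chord.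
    by_cases hB : i + 1 ∈ B
    · have hh : hi i = i + 1 := by rcases h5 _ hB with h | h <;> omega
      rw [hE0 _ hB (by omega)]
      simp only [p, E, if_pos hi', hh] at hpos ⊢
      push_cast at hpos ⊢
      field_simp
      ring
    · have hi1 : i + 1 < n := by
        rcases Nat.lt_or_ge (i + 1) n with h | h
        · exact h
        · exact absurd ((show i + 1 = n by omega) ▸ hn) hB
      obtain ⟨g1, g2, g3, g4, g5⟩ := hb (i + 1) hi1
      have hne : lo (i + 1) ≠ i + 1 := fun h => hB (h ▸ g1)
      have hne' : hi i ≠ i + 1 := fun h => hB (h ▸ h2)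
      have e1 : lo (i + 1) = lo i := by
        rcases h5 _ g1 with h | h <;> rcases g5 _ h1 with h' | h' <;> omega
      have e2 : hi (i + 1) = hi i := by
        rcases h5 _ g2 with h | h <;> rcases g5 _ h2 with h' | h' <;> omega
      simp only [p, E, if_pos hi', if_pos hi1, e1, e2]
      push_cast
      field_simp
      ring
  · have hp : ∀ i ∈ Finset.range n, p i ^ 2 ≤ M ^ 2 * (1 / ((hi i : ℝ) - lo i)) := by
      intro i hi'
      obtain ⟨h1, h2, h3, h4, h5⟩ := hb i (Finset.mem_range.1 hi')
      have hpos : 0 < (hi i : ℝ) - lo i := by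
        have : (lo i : ℝ) < hi i := by exact_mod_cast h3.trans_lt h4
        linarith
      have hz := hZ (lo i) (hi i) (h3.trans_lt h4) (hin i (Finset.mem_range.1 hi'))
      have hz2 : (Z (hi i) - Z (lo i)) ^ 2 ≤ M ^ 2 * ((hi i : ℝ) - lo i) := by
        rw [← sq_abs]
        calc |Z (hi i) - Z (lo i)| ^ 2 ≤ (M * √((hi i : ℝ) - lo i)) ^ 2 := by gcongr
          _ = _ := by rw [mul_pow, Real.sq_sqrt hpos.le]
      simp only [p, div_pow]
      rw [div_le_iff₀ (by positivity)]
      calc _ ≤ _ := hz2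
        _ = _ := by field_simp
    refine (Finset.sum_le_sum hp).trans ?_
    rw [← Finset.mul_sum]
    gcongr
    have hmaps : ∀ i ∈ Finset.range n, lo i ∈ B.erase n := by
      intro i hi'
      obtain ⟨h1, h2, h3, h4, h5⟩ := hb i (Finset.mem_range.1 hi')
      have := Finset.mem_range.1 hi'
      exact Finset.mem_erase.2 ⟨by omega, h1⟩
    -- Grouped by left end point, a block of length ℓ contributes at most ℓ · (1/ℓ) = 1. The point
    -- `n` is never a left end, hence `B.erase n`.
    rw [← Finset.sum_fiberwise_of_maps_to hmaps]
    calc _ ≤ ∑ a ∈ B.erase n, (1 : ℝ) := by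
          apply Finset.sum_le_sum
          intro a _
          rcases Finset.eq_empty_or_nonempty ((Finset.range n).filter (fun i => lo i = a)) with
            he | ⟨i, hi'⟩
          · rw [he]; simp
          rw [Finset.mem_filter, Finset.mem_range] at hi'
          obtain ⟨h1, h2, h3, h4, h5⟩ := hb i hi'.1
          have hhi : ∀ k, k < n → lo k = a → hi k = hi i := by
            intro k hk hka
            obtain ⟨g1, g2, g3, g4, g5⟩ := hb k hk
            rcases h5 _ g2 with h | h <;> rcases g5 _ h2 with h' | h' <;> omega
          have hsub : (Finset.range n).filter (fun i => lo i = a) ⊆ Finset.Ico a (hi i) := by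
            intro k hk
            rw [Finset.mem_filter, Finset.mem_range] at hk
            obtain ⟨g1, g2, g3, g4, g5⟩ := hb k hk.1
            have := hhi k hk.1 hk.2
            exact Finset.mem_Ico.2 ⟨by omega, by omega⟩
          have hai : a < hi i := by omega
          have hpos : 0 < (hi i : ℝ) - a := by
            have : (a : ℝ) < hi i := by exact_mod_cast hai
            linarith
          calc _ = ∑ k ∈ (Finset.range n).filter (fun i => lo i = a), 1 / ((hi i : ℝ) - a) := by
                apply Finset.sum_congr rfl
                intro k hk
                rw [Finset.mem_filter, Finset.mem_range] at hk
                rw [hhi k hk.1 hk.2, hk.2]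
            _ ≤ ∑ k ∈ Finset.Ico a (hi i), 1 / ((hi i : ℝ) - a) :=
                Finset.sum_le_sum_of_subset_of_nonneg hsub fun _ _ _ => by positivity
            _ = 1 := by
                rw [Finset.sum_const, Nat.card_Ico, nsmul_eq_mul, Nat.cast_sub hai.le]
                field_simp
      _ = _ := by simp
  · intro j hj
    obtain ⟨h1, h2, h3, h4, h5⟩ := hb j hj
    have hln : ((hi j : ℕ) : ℝ) ≤ n := by exact_mod_cast hin j hj
    have h3' : (lo j : ℝ) ≤ j := by exact_mod_cast h3
    have h4' : (j : ℝ) < hi j := by exact_mod_cast h4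
    have hl0 : (0 : ℝ) ≤ lo j := by positivity
    set x := √((j : ℝ) - lo j) with hx
    set y := √((hi j : ℝ) - j) with hy
    have hx2 : x ^ 2 = (j : ℝ) - lo j := Real.sq_sqrt (by linarith)
    have hy2 : y ^ 2 = (hi j : ℝ) - j := Real.sq_sqrt (by linarith)
    have hx0 : 0 ≤ x := Real.sqrt_nonneg _
    have hy0 : 0 ≤ y := Real.sqrt_nonneg _
    have hsum : x ^ 2 + y ^ 2 = (hi j : ℝ) - lo j := by rw [hx2, hy2]; ring
    have hspos : 0 < x ^ 2 + y ^ 2 := by rw [hsum]; linarith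
    have hz1 : |Z j - Z (lo j)| ≤ M * x := by
      rcases h3.eq_or_lt with h | h
      · simp only [h, sub_self, abs_zero]; positivity
      · exact hZ _ _ h hj.le
    have hz2 : |Z (hi j) - Z j| ≤ M * y := hZ _ _ h4 (hin j hj)
    have hEj : |E j| ≤ M * (y ^ 2 * x + x ^ 2 * y) / (x ^ 2 + y ^ 2) := by
      simp only [E, if_pos hj]
      rw [abs_div, ← hsum, abs_of_pos hspos, ← hx2, ← hy2]
      gcongr
      calc _ ≤ |y ^ 2 * (Z j - Z (lo j))| + |x ^ 2 * (Z (hi j) - Z j)| := abs_sub _ _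
        _ = y ^ 2 * |Z j - Z (lo j)| + x ^ 2 * |Z (hi j) - Z j| := by
            rw [abs_mul, abs_mul, abs_of_nonneg (sq_nonneg y), abs_of_nonneg (sq_nonneg x)]
        _ ≤ y ^ 2 * (M * x) + x ^ 2 * (M * y) := by gcongr
        _ = _ := by ring
    -- Both bounds on the bridge reduce to `bridge_weight_le`: its first half serves the global
    -- bound, its second half the bound by the distance to either block end.
    have red : ∀ c, √2 * (y ^ 2 * x + x ^ 2 * y) ≤ (x ^ 2 + y ^ 2) * c → √2 * |E j| ≤ M * c := by
      intro c hc
      calc √2 * |E j| ≤ √2 * (M * (y ^ 2 * x + x ^ 2 * y) / (x ^ 2 + y ^ 2)) := by gcongr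
        _ = M * (√2 * (y ^ 2 * x + x ^ 2 * y)) / (x ^ 2 + y ^ 2) := by ring
        _ ≤ M * ((x ^ 2 + y ^ 2) * c) / (x ^ 2 + y ^ 2) := by gcongr
        _ = M * c := by field_simp
    refine ⟨?_, fun t ht => ?_⟩
    · refine (red _ (bridge_weight_le hx0 hy0).1).trans ?_
      rw [hsum]
      gcongr
      linarith
    · rcases h5 t ht with h | h
      · have h' : (t : ℝ) ≤ lo j := by exact_mod_cast h
        have hxt : x ≤ √|(j : ℝ) - t| := by
          apply Real.sqrt_le_sqrt
          rw [abs_of_nonneg (by linarith)]; linarith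
        have := red _ (bridge_weight_le hx0 hy0).2
        calc _ ≤ M * (2 * x) := this
          _ ≤ M * (2 * √|(j : ℝ) - t|) := by gcongr
          _ = _ := by ring
      · have h' : (hi j : ℝ) ≤ t := by exact_mod_cast h
        have hyt : y ≤ √|(j : ℝ) - t| := by
          apply Real.sqrt_le_sqrt
          rw [abs_sub_comm, abs_of_nonneg (by linarith)]; linarith
        have := red (2 * y) (by
          have := (bridge_weight_le hy0 hx0).2
          rw [add_comm (x ^ 2) (y ^ 2), add_comm (y ^ 2 * x)]
          exact this)
        calc _ ≤ M * (2 * y) := this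
          _ ≤ M * (2 * √|(j : ℝ) - t|) := by gcongr
          _ = _ := by ring

/-! ### Bumps and the dual certificate -/

noncomputable section

/-- A bump of height one at the origin, vanishing beyond `Δ / 2`. -/
def bump (n Δ : ℕ) (x : ℝ) : ℝ := max 0 (1 - (2 * √(|x| / n) + 2 * |x| / Δ))

theorem bump_nonneg (n Δ : ℕ) (x : ℝ) : 0 ≤ bump n Δ x := le_max_left _ _

theorem bump_zero (n Δ : ℕ) : bump n Δ 0 = 1 := by simp [bump]

theorem bump_neg (n Δ : ℕ) (x : ℝ) : bump n Δ (-x) = bump n Δ x := by simp [bump]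

/-- The linear term of the profile serves this purpose only: it alone reaches 1 at distance Δ/2. The
square-root term is reserved for dominating the bridge. -/
theorem abs_lt_of_bump_ne_zero {n Δ : ℕ} (hΔ : 1 ≤ Δ) {x : ℝ} (h : bump n Δ x ≠ 0) :
    |x| < Δ / 2 := by
  by_contra! hx
  apply h
  apply max_eq_left
  have hΔ' : (0 : ℝ) < Δ := by exact_mod_cast hΔ
  have h1 : 1 ≤ 2 * |x| / Δ := by rw [le_div_iff₀ hΔ']; linarith
  have h2 := Real.sqrt_nonneg (|x| / n)
  linarith

theorem bump_le_of_ne_zero {n Δ : ℕ} {x : ℝ} (h : bump n Δ x ≠ 0) :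
    bump n Δ x ≤ 1 - 2 * √(|x| / n) := by
  have h0 : 0 < bump n Δ x := lt_of_le_of_ne (bump_nonneg _ _ _) (Ne.symm h)
  rw [bump, lt_max_iff] at h0
  have h1 := h0.resolve_left (lt_irrefl _)
  have h2 : 0 ≤ 2 * |x| / Δ := by positivity
  rw [bump, max_eq_right h1.le]
  linarith

/-- Clipping at zero is 1-Lipschitz, so a step is at most 2/√(n(d+1)) from the root plus 2/Δ from
the linear part; then (u + v)² ≤ 2u² + 2v². The root contributes a harmonic series, which is the
source of the log n in the final bound. -/
theorem bump_step_sq_le {n Δ : ℕ} (hn : 1 ≤ n) (hΔ : 1 ≤ Δ) (d : ℕ) :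
    (bump n Δ d - bump n Δ (d + 1)) ^ 2 ≤
      8 / n * (d + 1 : ℝ)⁻¹ + if d < Δ then 8 / (Δ : ℝ) ^ 2 else 0 := by
  have hΔ' : (0 : ℝ) < Δ := by exact_mod_cast hΔ
  have hn' : (0 : ℝ) < n := by exact_mod_cast hn
  split_ifs with hd
  · have hd0 : (0 : ℝ) ≤ d := by positivity
    have hd1 : (0 : ℝ) ≤ d + 1 := by positivity
    have hr : √((d + 1 : ℝ)) - √d ≤ 1 / √(d + 1 : ℝ) := by
      rw [le_div_iff₀ (by positivity)]
      have a1 := Real.mul_self_sqrt hd0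
      have a2 := Real.mul_self_sqrt hd1
      have a3 : √(d : ℝ) ≤ √(d + 1 : ℝ) := Real.sqrt_le_sqrt (by linarith)
      nlinarith [Real.sqrt_nonneg (d : ℝ)]
    have hle : √(d : ℝ) ≤ √(d + 1 : ℝ) := Real.sqrt_le_sqrt (by linarith)
    have habs : |bump n Δ d - bump n Δ (d + 1)| ≤
        2 * ((√(d + 1 : ℝ) - √d) / √n) + 2 / Δ := by
      have h := abs_max_sub_max_le_abs (1 - (2 * √(|(d : ℝ)| / n) + 2 * |(d : ℝ)| / Δ))
        (1 - (2 * √(|(d + 1 : ℝ)| / n) + 2 * |(d + 1 : ℝ)| / Δ)) 0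
      rw [max_comm, max_comm (1 - _) (0 : ℝ)] at h
      refine h.trans_eq ?_
      rw [abs_of_nonneg hd0, abs_of_nonneg hd1, Real.sqrt_div hd0, Real.sqrt_div hd1]
      have : 1 - (2 * (√(d : ℝ) / √n) + 2 * d / Δ) - (1 - (2 * (√(d + 1 : ℝ) / √n) +
          2 * (d + 1) / Δ)) = 2 * ((√(d + 1 : ℝ) - √d) / √n) + 2 / Δ := by ring
      rw [this, abs_of_nonneg]
      have : 0 ≤ √(d + 1 : ℝ) - √d := by linarith
      positivity
    have hstep : 2 * ((√(d + 1 : ℝ) - √d) / √n) + 2 / Δ ≤ 2 * (1 / √(d + 1 : ℝ) / √n) + 2 / Δ := by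
      gcongr
    rw [← sq_abs]
    calc |bump n Δ d - bump n Δ (d + 1)| ^ 2 ≤ (2 * (1 / √(d + 1 : ℝ) / √n) + 2 / Δ) ^ 2 := by
          gcongr; exact habs.trans hstep
      _ ≤ 2 * ((2 * (1 / √(d + 1 : ℝ) / √n)) ^ 2 + (2 / Δ) ^ 2) := add_sq_le
      _ = _ := by
          rw [mul_pow, div_pow, div_pow, div_pow, Real.sq_sqrt hd1, Real.sq_sqrt hn'.le]
          field_simp
          ring
  · have hz : ∀ x : ℝ, (Δ : ℝ) ≤ x → bump n Δ x = 0 := by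
      intro x hx
      by_contra h
      have := abs_lt_of_bump_ne_zero hΔ h
      have := le_abs_self x
      linarith
    have hd' : (Δ : ℝ) ≤ d := by exact_mod_cast not_lt.1 hd
    rw [hz _ hd', hz _ (by linarith)]
    have : 0 ≤ 8 / (n : ℝ) * (d + 1 : ℝ)⁻¹ := by positivity
    simpa using this

theorem sum_bump_step_sq_le {n Δ : ℕ} (hn : 1 ≤ n) (hΔ : 1 ≤ Δ) {k : ℕ} (hk : k ≤ n) :
    ∑ d ∈ Finset.range k, (bump n Δ d - bump n Δ (d + 1)) ^ 2 ≤
      8 / n * (1 + Real.log n) + 8 / Δ := by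
  have hΔ' : (0 : ℝ) < Δ := by exact_mod_cast hΔ
  calc _ ≤ ∑ d ∈ Finset.range n, (bump n Δ d - bump n Δ (d + 1)) ^ 2 :=
        Finset.sum_le_sum_of_subset_of_nonneg (Finset.range_mono hk) fun _ _ _ => sq_nonneg _
    _ ≤ ∑ d ∈ Finset.range n, (8 / n * (d + 1 : ℝ)⁻¹ + if d < Δ then 8 / (Δ : ℝ) ^ 2 else 0) :=
        Finset.sum_le_sum fun d _ => bump_step_sq_le hn hΔ d
    _ ≤ _ := by
        rw [Finset.sum_add_distrib, ← Finset.mul_sum]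
        gcongr
        · have := harmonic_le_one_add_log n
          simpa [harmonic] using this
        · rw [← Finset.sum_filter]
          calc _ ≤ ∑ d ∈ Finset.range Δ, 8 / (Δ : ℝ) ^ 2 := by
                apply Finset.sum_le_sum_of_subset_of_nonneg
                · intro d hd
                  exact Finset.mem_range.2 (Finset.mem_filter.1 hd).2
                · intros; positivity
            _ = _ := by
                rw [Finset.sum_const, Finset.card_range, nsmul_eq_mul]
                field_simp

/-- The bump is even, so the steps left of the peak, reflected, and those right of it are each
bounded by a one-sided sum; hence the factor 2. -/
theorem sum_shifted_bump_step_sq_le {n Δ : ℕ} (hn : 1 ≤ n) (hΔ : 1 ≤ Δ) {t : ℕ} (ht : t < n) :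
    ∑ j ∈ Finset.range n, (bump n Δ ((j : ℝ) - t) - bump n Δ (((j + 1 : ℕ) : ℝ) - t)) ^ 2 ≤
      2 * (8 / n * (1 + Real.log n) + 8 / Δ) := by
  rw [← Finset.sum_range_add_sum_Ico _ ht.le, two_mul]
  apply add_le_add
  · refine le_of_eq_of_le ?_ (sum_bump_step_sq_le hn hΔ ht.le)
    rw [← Finset.sum_range_reflect]
    apply Finset.sum_congr rfl
    intro d hd
    have hd := Finset.mem_range.1 hd
    have e1 : ((t - 1 - d : ℕ) : ℝ) - t = -((d : ℝ) + 1) := by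
      have : t - 1 - d + (d + 1) = t := by omega
      have : ((t - 1 - d : ℕ) : ℝ) + (d + 1) = t := by exact_mod_cast this
      linarith
    have e2 : ((t - 1 - d + 1 : ℕ) : ℝ) - t = -(d : ℝ) := by push_cast; linarith
    rw [e1, e2, bump_neg, bump_neg]
    ring
  · rw [Finset.sum_Ico_eq_sum_range]
    refine le_of_eq_of_le ?_ (sum_bump_step_sq_le hn hΔ (Nat.sub_le n t))
    apply Finset.sum_congr rfl
    intro d _
    push_cast
    congr 3 <;> ring

/-- A superposition of signed bumps at well separated points. -/
def certificate (n Δ : ℕ) (T : Finset ℕ) (σ : ℕ → ℝ) (j : ℕ) : ℝ :=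
  ∑ t ∈ T, σ t * bump n Δ ((j : ℝ) - t)

section

variable {n Δ : ℕ} {T : Finset ℕ} {σ : ℕ → ℝ}

theorem eq_of_bump_ne_zero (hΔ : 1 ≤ Δ) {B : Finset ℕ}
    (hsep : ∀ a ∈ B, ∀ b ∈ B, a < b → a + Δ ≤ b) {a b j : ℕ} (ha : a ∈ B) (hb : b ∈ B)
    (h : bump n Δ ((j : ℝ) - a) ≠ 0) (h' : bump n Δ ((j : ℝ) - b) ≠ 0) : a = b := by
  have h1 := abs_lt.1 (abs_lt_of_bump_ne_zero hΔ h)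
  have h2 := abs_lt.1 (abs_lt_of_bump_ne_zero hΔ h')
  by_contra hab
  rcases lt_or_gt_of_ne hab with hlt | hlt
  · have : (a : ℝ) + Δ ≤ b := by exact_mod_cast hsep a ha b hb hlt
    linarith
  · have : (b : ℝ) + Δ ≤ a := by exact_mod_cast hsep b hb a ha hlt
    linarith

theorem certificate_eq (hΔ : 1 ≤ Δ) {B : Finset ℕ} (hTB : T ⊆ B)
    (hsep : ∀ a ∈ B, ∀ b ∈ B, a < b → a + Δ ≤ b) {t j : ℕ} (ht : t ∈ T)
    (h : bump n Δ ((j : ℝ) - t) ≠ 0) :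
    certificate n Δ T σ j = σ t * bump n Δ ((j : ℝ) - t) := by
  refine Finset.sum_eq_single_of_mem t ht fun b hb hbt => ?_
  by_cases hz : bump n Δ ((j : ℝ) - b) = 0
  · rw [hz, mul_zero]
  · exact absurd (eq_of_bump_ne_zero hΔ hsep (hTB hb) (hTB ht) hz h) hbt

theorem certificate_of_mem (hΔ : 1 ≤ Δ) {B : Finset ℕ} (hTB : T ⊆ B)
    (hsep : ∀ a ∈ B, ∀ b ∈ B, a < b → a + Δ ≤ b) {t : ℕ} (ht : t ∈ T) :
    certificate n Δ T σ t = σ t := by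
  rw [certificate_eq hΔ hTB hsep ht] <;> simp [bump_zero]

theorem certificate_of_mem_of_notMem (hΔ : 1 ≤ Δ) {B : Finset ℕ} (hTB : T ⊆ B)
    (hsep : ∀ a ∈ B, ∀ b ∈ B, a < b → a + Δ ≤ b) {b : ℕ} (hb : b ∈ B) (hbT : b ∉ T) :
    certificate n Δ T σ b = 0 := by
  refine Finset.sum_eq_zero fun t ht => ?_
  by_cases hz : bump n Δ ((b : ℝ) - t) = 0
  · rw [hz, mul_zero]
  · have := eq_of_bump_ne_zero (b := b) hΔ hsep (hTB ht) hb hz (by simp [bump_zero])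
    exact absurd (this ▸ ht) hbT

/-- At most one bump is active at `j`, and its square-root cusp already lies `w` below 1. In the
application `w` is |E_j|/ν. -/
theorem abs_certificate_le (hΔ : 1 ≤ Δ) {B : Finset ℕ} (hTB : T ⊆ B)
    (hsep : ∀ a ∈ B, ∀ b ∈ B, a < b → a + Δ ≤ b) (hσ : ∀ t, |σ t| ≤ 1) {w : ℝ} {j : ℕ}
    (hw : w ≤ 1) (hwt : ∀ t ∈ B, w ≤ 2 * √(|(j : ℝ) - t| / n)) :
    |certificate n Δ T σ j| ≤ 1 - w := by
  by_cases h : ∃ t ∈ T, bump n Δ ((j : ℝ) - t) ≠ 0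
  · obtain ⟨t, ht, hne⟩ := h
    rw [certificate_eq hΔ hTB hsep ht hne, abs_mul, abs_of_nonneg (bump_nonneg _ _ _)]
    have h1 := bump_le_of_ne_zero hne
    have h2 := hwt t (hTB ht)
    have h3 := mul_le_of_le_one_left (bump_nonneg n Δ ((j : ℝ) - t)) (hσ t)
    linarith
  · push Not at h
    rw [certificate, Finset.sum_eq_zero fun t ht => by rw [h t ht, mul_zero], abs_zero]
    linarith

theorem sum_certificate_step_sq_le (hn : 1 ≤ n) (hΔ : 1 ≤ Δ) (hT : ∀ t ∈ T, t < n)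
    (hsep : ∀ a ∈ T, ∀ b ∈ T, a < b → a + Δ ≤ b) (hσ : ∀ t, |σ t| ≤ 1) :
    ∑ j ∈ Finset.range n, (certificate n Δ T σ j - certificate n Δ T σ (j + 1)) ^ 2 ≤
      T.card * (4 * (8 / n * (1 + Real.log n) + 8 / Δ)) := by
  have hstep : ∀ j ∈ Finset.range n,
      (certificate n Δ T σ j - certificate n Δ T σ (j + 1)) ^ 2 ≤
        2 * ∑ t ∈ T, (bump n Δ ((j : ℝ) - t) - bump n Δ (((j + 1 : ℕ) : ℝ) - t)) ^ 2 := by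
    intro j _
    set g : ℕ → ℝ := fun t => bump n Δ ((j : ℝ) - t) - bump n Δ (((j + 1 : ℕ) : ℝ) - t) with hg
    -- A step from `j` to `j + 1` may leave one bump and enter another, so at most two terms survive
    -- and Cauchy–Schwarz costs a factor 2.
    set S := T.filter (fun t : ℕ => bump n Δ ((j : ℝ) - t) ≠ 0) ∪
      T.filter (fun t : ℕ => bump n Δ (((j + 1 : ℕ) : ℝ) - t) ≠ 0) with hS
    have hone : ∀ i : ℕ, (T.filter (fun t : ℕ => bump n Δ ((i : ℝ) - t) ≠ 0)).card ≤ 1 := by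
      intro i
      refine Finset.card_le_one.2 fun a ha b hb => ?_
      rw [Finset.mem_filter] at ha hb
      exact eq_of_bump_ne_zero hΔ hsep ha.1 hb.1 ha.2 hb.2
    have hcard : (S.card : ℝ) ≤ 2 := by
      have h2 : S.card ≤ 2 :=
        (Finset.card_union_le _ _).trans (add_le_add (hone j) (hone (j + 1)))
      exact_mod_cast h2
    have hST : S ⊆ T := Finset.union_subset (Finset.filter_subset _ _) (Finset.filter_subset _ _)
    have hdiff : certificate n Δ T σ j - certificate n Δ T σ (j + 1) = ∑ t ∈ S, σ t * g t := by
      rw [certificate, certificate, ← Finset.sum_sub_distrib]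
      simp_rw [← mul_sub]
      symm
      refine Finset.sum_subset hST fun t ht htS => ?_
      rw [hS, Finset.mem_union, Finset.mem_filter, Finset.mem_filter] at htS
      push Not at htS
      simp only [hg, htS.1 ht, htS.2 ht, sub_self, mul_zero]
    rw [hdiff]
    calc (∑ t ∈ S, σ t * g t) ^ 2 ≤ S.card * ∑ t ∈ S, (σ t * g t) ^ 2 := sq_sum_le_card_mul_sum_sq
      _ ≤ 2 * ∑ t ∈ T, (g t) ^ 2 := by
          refine mul_le_mul hcard ?_ (Finset.sum_nonneg fun _ _ => sq_nonneg _) (by norm_num)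
          refine (Finset.sum_le_sum fun t _ => ?_).trans
            (Finset.sum_le_sum_of_subset_of_nonneg hST fun _ _ _ => sq_nonneg _)
          rw [mul_pow]
          exact mul_le_of_le_one_left (sq_nonneg _) ((sq_le_one_iff_abs_le_one _).2 (hσ t))
  refine (Finset.sum_le_sum hstep).trans ?_
  rw [← Finset.mul_sum, Finset.sum_comm]
  calc _ ≤ 2 * ∑ t ∈ T, 2 * (8 / (n : ℝ) * (1 + Real.log n) + 8 / Δ) := by
        gcongr with t ht
        exact sum_shifted_bump_step_sq_le hn hΔ (hT t ht)
    _ = _ := by rw [Finset.sum_const, nsmul_eq_mul]; ring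

end

end

/-! ### Absorbing the noise into the penalty and the quadratic term -/

theorem sum_mul_increment (h q : ℕ → ℝ) (n : ℕ) :
    ∑ j ∈ Finset.range n, q j * (h j - if j = 0 then 0 else h (j - 1)) =
      ∑ j ∈ Finset.range n, h j * (q j - q (j + 1)) +
        q n * (if n = 0 then 0 else h (n - 1)) := by
  induction n with
  | zero => simp
  | succ k ih =>
    rw [Finset.sum_range_succ, Finset.sum_range_succ, ih]
    simp only [Nat.add_sub_cancel, if_neg k.succ_ne_zero]
    ring

/-- The deterministic core: if the noise sums over intervals are controlled, then the noise term
and the penalty on `T` are absorbed by the quadratic term and the penalty off `T`. -/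
theorem noise_add_penalty_le {n Δ : ℕ} (hn : 1 ≤ n) (hΔ : 1 ≤ Δ) {T : Finset ℕ}
    (hT : ∀ t ∈ T, t < n)
    (hsep : ∀ a ∈ insert 0 (insert n T), ∀ b ∈ insert 0 (insert n T), a < b → a + Δ ≤ b)
    {M ν : ℝ} (hM : 0 ≤ M) (hν : 0 < ν) (hMν : M * √n ≤ √2 * ν) (ξ h : ℕ → ℝ)
    (hξ : ∀ a b, a < b → b ≤ n → |∑ i ∈ Finset.Ico a b, ξ i| ≤ M * √((b : ℝ) - a))
    (β : ℕ → ℝ) (hβ : ∀ j, β j = h j - if j = 0 then 0 else h (j - 1)) :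
    ∑ j ∈ Finset.range n, (2 * (ξ j * h j) + 2 * ν * if j ∈ T then |β j| else -|β j|) ≤
      ∑ j ∈ Finset.range n, h j ^ 2 + 5 * (M ^ 2 * (T.card + 1)) +
        5 / 4 * (ν ^ 2 * (T.card * (4 * (8 / n * (1 + Real.log n) + 8 / Δ)))) := by
  set B := insert 0 (insert n T) with hB
  have h0B : 0 ∈ B := by simp [hB]
  have hnB : n ∈ B := by simp [hB]
  have hTB : T ⊆ B := fun t ht => by simp [hB, ht]
  have hnT : n ∉ T := fun hmem => lt_irrefl n (hT n hmem)
  have hn0 : (0 : ℝ) < n := by exact_mod_cast hn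
  have h2 : (0 : ℝ) < √2 := Real.sqrt_pos.2 (by norm_num)
  obtain ⟨p, E, hpE, hE0, hp, hE⟩ := exists_interpolation (Z := fun i => ∑ l ∈ Finset.range i, ξ l)
    h0B hnB hM fun a b hab hbn => by
      rw [← Finset.sum_Ico_eq_sub _ hab.le]
      exact hξ a b hab hbn
  simp only [Finset.sum_range_succ, add_sub_cancel_left] at hpE
  let σ : ℕ → ℝ := fun t => (SignType.sign (β t) : ℝ)
  have hσ : ∀ t, |σ t| ≤ 1 := fun t => by
    simp only [σ]
    rcases lt_trichotomy (β t) 0 with h | h | h <;> simp [h]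
  have hσβ : ∀ t, σ t * β t = |β t| := fun t => sign_mul_self _
  set q := certificate n Δ T σ with hq
  have hEβ := sum_mul_increment h E n
  have hqβ := sum_mul_increment h q n
  rw [hE0 n hnB le_rfl, zero_mul, add_zero] at hEβ
  -- The boundary term of the summation by parts vanishes because `n` is a break point outside `T`,
  -- so no bump reaches it.
  rw [hq, certificate_of_mem_of_notMem hΔ hTB hsep hnB hnT, zero_mul, add_zero, ← hq] at hqβ
  simp only [← hβ] at hEβ hqβ
  -- On `T` the bridge is zero and `q` is the sign, giving equality; off `T` the requirement is
  -- |E_j| + ν|q_j| ≤ ν.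
  have hpt : ∀ j ∈ Finset.range n,
      -2 * (E j * β j) + 2 * ν * (if j ∈ T then |β j| else -|β j|) ≤ 2 * ν * (q j * β j) := by
    intro j hj
    have hjn := Finset.mem_range.1 hj
    split_ifs with hjT
    · rw [hE0 j (hTB hjT) hjn.le, hq, certificate_of_mem hΔ hTB hsep hjT, hσβ]
      simp
    · have hw : |q j| ≤ 1 - |E j| / ν := by
        refine abs_certificate_le hΔ hTB hsep hσ ?_ fun t ht => ?_
        · rw [div_le_one hν]
          exact le_of_mul_le_mul_left ((hE j hjn).1.trans hMν) h2
        · rw [div_le_iff₀ hν, Real.sqrt_div (abs_nonneg _)]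
          have h3 := (hE j hjn).2 t ht
          set r := √|(j : ℝ) - t|
          have hr : 0 ≤ r := Real.sqrt_nonneg _
          have hsn : 0 < √(n : ℝ) := Real.sqrt_pos.2 hn0
          have h4 : 2 * (r / √n) * ν = 2 * r * ν / √n := by ring
          rw [h4, le_div_iff₀ hsn]
          apply le_of_mul_le_mul_left _ h2
          calc √2 * (|E j| * √n) = √2 * |E j| * √n := by ring
            _ ≤ 2 * M * r * √n := by gcongr
            _ = 2 * r * (M * √n) := by ring
            _ ≤ 2 * r * (√2 * ν) := by gcongr
            _ = _ := by ring
      have hνq : ν * |q j| ≤ ν - |E j| := by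
        calc ν * |q j| ≤ ν * (1 - |E j| / ν) := by gcongr
          _ = _ := by field_simp
      have h5 : -(E j * β j) ≤ |E j| * |β j| := by rw [← abs_mul]; exact neg_le_abs _
      have h6 : -(|q j| * |β j|) ≤ q j * β j := by rw [← abs_mul]; exact neg_abs_le _
      have h7 := mul_le_mul_of_nonneg_right hνq (abs_nonneg (β j))
      have h8 := mul_le_mul_of_nonneg_left h6 hν.le
      nlinarith
  have hpt' := Finset.sum_le_sum hpt
  rw [Finset.sum_add_distrib, ← Finset.mul_sum, ← Finset.mul_sum (a := 2 * ν) (f := fun j =>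
    q j * β j), hEβ, hqβ] at hpt'
  have hB1 : ((B.erase n).card : ℝ) ≤ T.card + 1 := by
    have hsub : B.erase n ⊆ insert 0 T := by
      intro x hx
      rw [Finset.mem_erase, hB, Finset.mem_insert, Finset.mem_insert] at hx
      rw [Finset.mem_insert]
      tauto
    have := (Finset.card_le_card hsub).trans (Finset.card_insert_le _ _)
    exact_mod_cast this
  have hsq := sum_certificate_step_sq_le hn hΔ hT
    (fun a ha b hb => hsep a (hTB ha) b (hTB hb)) hσ
  rw [← hq] at hsq
  have hnoise : ∑ j ∈ Finset.range n, 2 * (ξ j * h j) = ∑ j ∈ Finset.range n, 2 * (p j * h j) +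
      -2 * ∑ j ∈ Finset.range n, h j * (E j - E (j + 1)) := by
    rw [Finset.mul_sum, ← Finset.sum_add_distrib]
    refine Finset.sum_congr rfl fun j hj => ?_
    rw [hpE j (Finset.mem_range.1 hj)]
    ring
  rw [Finset.sum_add_distrib]
  calc _ = ∑ j ∈ Finset.range n, 2 * (p j * h j) +
        (-2 * ∑ j ∈ Finset.range n, h j * (E j - E (j + 1)) +
          ∑ j ∈ Finset.range n, 2 * ν * (if j ∈ T then |β j| else -|β j|)) := by
        rw [← add_assoc, hnoise]
    _ ≤ ∑ j ∈ Finset.range n, 2 * (p j * h j) +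
        2 * ν * ∑ j ∈ Finset.range n, h j * (q j - q (j + 1)) := by gcongr
    _ = ∑ j ∈ Finset.range n, 2 * (h j * (p j + ν * (q j - q (j + 1)))) := by
        rw [Finset.mul_sum, ← Finset.sum_add_distrib]
        exact Finset.sum_congr rfl fun j _ => by ring
    -- Here 2h(p + r) ≤ h² + (p + r)², and (p + r)² ≤ (1 + 4)p² + (1 + 1/4)r².
    _ ≤ ∑ j ∈ Finset.range n,
        (h j ^ 2 + 5 * p j ^ 2 + 5 / 4 * (ν ^ 2 * (q j - q (j + 1)) ^ 2)) := by
        refine Finset.sum_le_sum fun j _ => ?_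
        set r := ν * (q j - q (j + 1)) with hr
        rw [← mul_pow, ← hr]
        nlinarith [sq_nonneg (h j - (p j + r)), sq_nonneg (4 * p j - r)]
    _ = ∑ j ∈ Finset.range n, h j ^ 2 + 5 * ∑ j ∈ Finset.range n, p j ^ 2 +
        5 / 4 * (ν ^ 2 * ∑ j ∈ Finset.range n, (q j - q (j + 1)) ^ 2) := by
        simp only [Finset.sum_add_distrib, Finset.mul_sum]
    _ ≤ _ := by
        gcongr
        exact hp.trans (by gcongr)

/-! ### Increments, the Lasso reformulation and the basic inequality -/

theorem incr_injective {n : ℕ} : Function.Injective (incr (n := n)) := by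
  intro f g hfg
  have key : ∀ k (hk : k < n), f ⟨k, hk⟩ = g ⟨k, hk⟩ := by
    intro k
    induction k with
    | zero =>
      intro hk
      simpa [incr] using congrFun hfg ⟨0, hk⟩
    | succ k ih =>
      intro hk
      have h := congrFun hfg ⟨k + 1, hk⟩
      have h' := ih (by omega)
      simp only [incr, Nat.add_sub_cancel, if_neg k.succ_ne_zero] at h
      linarith
  exact funext fun i => key i i.isLt

theorem incr_tvDesign_mulVec {n : ℕ} (b : Fin n → ℝ) : incr ((tvDesign n).mulVec b) = b := by
  funext i
  have hX : ∀ k, (tvDesign n).mulVec b k = ∑ j, if j ≤ k then b j else 0 := fun k => by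
    simp [Matrix.mulVec, dotProduct, tvDesign]
  by_cases hi : (i : ℕ) = 0
  · simp only [incr, hi, if_true, sub_zero, hX]
    rw [Finset.sum_eq_single i]
    · simp
    · intro j _ hj
      rw [if_neg]
      intro hle
      have h1 : (j : ℕ) ≤ i := hle
      exact hj (Fin.ext (by omega))
    · simp
  · simp only [incr, if_neg hi, hX]
    rw [← Finset.sum_sub_distrib, Finset.sum_eq_single i]
    · rw [if_pos le_rfl, if_neg, sub_zero]
      rw [Fin.le_def]
      simp only
      omega
    · intro j _ hj
      have hj' : (j : ℕ) ≠ i := fun h => hj (Fin.ext h)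
      by_cases hle : (j : ℕ) ≤ i
      · rw [if_pos (Fin.le_def.2 hle), if_pos (Fin.le_def.2 (by simp only; omega)), sub_self]
      · rw [if_neg (fun h => hle (Fin.le_def.1 h)), if_neg, sub_self]
        intro h
        have h1 := Fin.le_def.1 h
        simp only at h1
        omega
    · simp

theorem tvDesign_mulVec_incr {n : ℕ} (f : Fin n → ℝ) : (tvDesign n).mulVec (incr f) = f :=
  incr_injective (incr_tvDesign_mulVec _)

/-- The Lasso fit for the triangular design is the TV estimator with twice the penalty level. -/
theorem IsLasso.isTVEstimator {n : ℕ} {lam : ℝ} {y b : Fin n → ℝ}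
    (h : IsLasso (tvDesign n) lam y b) :
    IsTVEstimator (2 * lam) y ((tvDesign n).mulVec b) := by
  intro g
  have h1 := h (incr g)
  rw [tvDesign_mulVec_incr] at h1
  simp only [tv, tvOn, incr_tvDesign_mulVec]
  have e : (1 : ℝ) / (2 * n) = 1 / 2 * (1 / n) := by rw [one_div_mul_one_div]
  rw [e] at h1
  linarith

theorem sqNorm_nonneg {n : ℕ} (v : Fin n → ℝ) : 0 ≤ sqNorm v :=
  Finset.sum_nonneg fun _ _ => sq_nonneg _

theorem tvOn_nonneg {n : ℕ} (S : Finset (Fin n)) (v : Fin n → ℝ) : 0 ≤ tvOn S v :=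
  Finset.sum_nonneg fun _ _ => abs_nonneg _

theorem incr_lineMap {n : ℕ} (f g : Fin n → ℝ) (t : ℝ) (j : Fin n) :
    incr (fun i => (1 - t) * f i + t * g i) j = (1 - t) * incr f j + t * incr g j := by
  simp only [incr]
  split_ifs <;> ring

theorem incr_sub {n : ℕ} (f g : Fin n → ℝ) (j : Fin n) :
    incr (f - g) j = incr f j - incr g j := by
  simp only [incr, Pi.sub_apply]
  split_ifs <;> ring

theorem tv_lineMap_le {n : ℕ} (f g : Fin n → ℝ) {t : ℝ} (h0 : 0 ≤ t) (h1 : t ≤ 1) :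
    tv (fun i => (1 - t) * f i + t * g i) ≤ (1 - t) * tv f + t * tv g := by
  simp only [tv, tvOn]
  rw [Finset.mul_sum, Finset.mul_sum, ← Finset.sum_add_distrib]
  refine Finset.sum_le_sum fun j _ => ?_
  rw [incr_lineMap]
  refine (abs_add_le _ _).trans_eq ?_
  rw [abs_mul, abs_mul, abs_of_nonneg h0, abs_of_nonneg (sub_nonneg.2 h1)]

/-- The basic inequality for the penalized estimator, with the curvature term. -/
theorem IsTVEstimator.basic_inequality {n : ℕ} {μ : ℝ} (hμ : 0 ≤ μ) {fstar ξ f : Fin n → ℝ}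
    (h : IsTVEstimator μ (fun i => fstar i + ξ i) f) (g : Fin n → ℝ) :
    1 / (n : ℝ) * sqNorm (f - fstar) + 1 / (n : ℝ) * sqNorm (f - g) ≤
      1 / (n : ℝ) * sqNorm (g - fstar) + 1 / (n : ℝ) * ∑ i, 2 * (ξ i * (f - g) i) +
        μ * (tv g - tv f) := by
  set y : Fin n → ℝ := fun i => fstar i + ξ i with hy
  set I := ∑ i, (y i - f i) * (g i - f i) with hI
  set D := sqNorm (f - g) with hD
  have hD0 : 0 ≤ D := sqNorm_nonneg _
  have hexp : ∀ t : ℝ, sqNorm (y - fun i => (1 - t) * f i + t * g i) =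
      sqNorm (y - f) - 2 * t * I + t ^ 2 * D := by
    intro t
    simp only [hI, hD, sqNorm, Pi.sub_apply]
    rw [Finset.mul_sum, Finset.mul_sum, ← Finset.sum_sub_distrib, ← Finset.sum_add_distrib]
    exact Finset.sum_congr rfl fun i _ => by ring
  -- Minimality is tested on the segment from `f` to `g`; dividing by `t` and letting it tend to 0
  -- yields the first-order condition, which is stronger than comparing with `g` directly.
  have hstep : ∀ t : ℝ, 0 < t → t ≤ 1 →
      0 ≤ -(1 / (n : ℝ) * (2 * I)) + μ * (tv g - tv f) + t * (1 / (n : ℝ) * D) := by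
    intro t ht ht1
    have h1 := h fun i => (1 - t) * f i + t * g i
    rw [hexp] at h1
    have h2 := mul_le_mul_of_nonneg_left (tv_lineMap_le f g ht.le ht1) hμ
    have h3 : 0 ≤ t * (-(1 / (n : ℝ) * (2 * I)) + μ * (tv g - tv f) +
        t * (1 / (n : ℝ) * D)) := by linarith
    exact nonneg_of_mul_nonneg_right h3 ht
  have hlim : 0 ≤ -(1 / (n : ℝ) * (2 * I)) + μ * (tv g - tv f) := by
    apply le_of_forall_pos_le_add
    intro ε hε
    set c := 1 / (n : ℝ) * D
    have hc : 0 ≤ c := by positivity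
    -- The denominator is `c + 1` because `c` may be zero.
    have h1 := hstep (min 1 (ε / (c + 1))) (by positivity) (min_le_left _ _)
    have h2 : min 1 (ε / (c + 1)) * c ≤ ε := by
      calc _ ≤ ε / (c + 1) * c := by gcongr; exact min_le_right _ _
        _ = ε * (c / (c + 1)) := by ring
        _ ≤ ε * 1 := by
            gcongr
            rw [div_le_one (by positivity)]; linarith
        _ = ε := mul_one _
    linarith
  have halg : sqNorm (f - fstar) + D = sqNorm (g - fstar) + ∑ i, 2 * (ξ i * (f - g) i) + 2 * I := by
    simp only [hI, hD, hy, sqNorm, Pi.sub_apply]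
    rw [Finset.mul_sum, ← Finset.sum_add_distrib, ← Finset.sum_add_distrib,
      ← Finset.sum_add_distrib]
    exact Finset.sum_congr rfl fun i _ => by ring
  have halg' := congrArg (fun z => 1 / (n : ℝ) * z) halg
  simp only [mul_add] at halg'
  linarith

/-- The triangle inequality, used in opposite directions on and off `T`; off `T` it reads |g| - |f|
≤ 2|g| - |f - g| for the increments. The negative term is kept because it pays for the bridge. -/
theorem tv_sub_tv_le {n : ℕ} (T : Finset (Fin n)) (f g : Fin n → ℝ) :
    tv g - tv f ≤ 2 * tvOn Tᶜ g +
      ∑ j, if j ∈ T then |incr (f - g) j| else -|incr (f - g) j| := by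
  have e : tvOn Tᶜ g = ∑ j, if j ∈ T then 0 else |incr g j| := by
    rw [tvOn, ← Finset.sum_compl_add_sum T, Finset.sum_congr rfl fun j hj => if_pos hj]
    rw [Finset.sum_const_zero, add_zero]
    exact Finset.sum_congr rfl fun j hj => (if_neg (Finset.mem_compl.1 hj)).symm
  rw [e, tv, tv, tvOn, tvOn, Finset.mul_sum, ← Finset.sum_sub_distrib, ← Finset.sum_add_distrib]
  refine Finset.sum_le_sum fun j _ => ?_
  rw [incr_sub]
  split_ifs
  · have := abs_sub_abs_le_abs_sub (incr g j) (incr f j)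
    rw [abs_sub_comm] at this
    linarith
  · have := abs_sub (incr f j) (incr g j)
    linarith

/-! ### Spacing of break points and transfer to vectors on `Fin n` -/

theorem minGap_le {n : ℕ} {T : Finset (Fin n)} {a b : ℕ} (ha : a ∈ breakpoints T)
    (hb : b ∈ breakpoints T) (hab : a < b) : minGap T ≤ b - a :=
  Nat.sInf_le ⟨a, ha, b, hb, hab, rfl⟩

theorem minGap_le_card {n : ℕ} (hn : 1 ≤ n) (T : Finset (Fin n)) : minGap T ≤ n := by
  have := minGap_le (T := T) (a := 1) (b := n + 1) (by simp [breakpoints]) (by simp [breakpoints])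
    (by omega)
  simpa using this

theorem one_le_minGap {n : ℕ} (hn : 1 ≤ n) (T : Finset (Fin n)) : 1 ≤ minGap T := by
  have hne : {d : ℕ | ∃ a ∈ breakpoints T, ∃ b ∈ breakpoints T, a < b ∧ d = b - a}.Nonempty :=
    ⟨n, 1, by simp [breakpoints], n + 1, by simp [breakpoints], by omega, by omega⟩
  obtain ⟨a, _, b, _, hab, hd⟩ := Nat.sInf_mem hne
  rw [minGap, hd]
  omega

/-- Extension of a finite vector by zero. -/
noncomputable def extend {n : ℕ} (f : Fin n → ℝ) (i : ℕ) : ℝ := if h : i < n then f ⟨i, h⟩ else 0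

theorem extend_val {n : ℕ} (f : Fin n → ℝ) (i : Fin n) : extend f i = f i := by simp [extend]

theorem incr_eq_extend {n : ℕ} (f : Fin n → ℝ) (j : Fin n) :
    incr f j = extend f j - if (j : ℕ) = 0 then 0 else extend f (j - 1) := by
  rw [incr, extend_val]
  split_ifs with h
  · rfl
  · rw [extend, dif_pos]

/-- The deterministic core for vectors indexed by `Fin n`. -/
theorem noise_add_penalty_le_fin {n : ℕ} (hn : 1 ≤ n) (T : Finset (Fin n)) {M ν : ℝ} (hM : 0 ≤ M)
    (hν : 0 < ν) (hMν : M * √n ≤ √2 * ν) (ξ h : Fin n → ℝ)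
    (hξ : ∀ a b, |∑ i ∈ Finset.Icc a b, ξ i| ≤ M * √((Finset.Icc a b).card)) :
    ∑ i, 2 * (ξ i * h i) + 2 * ν * ∑ j, (if j ∈ T then |incr h j| else -|incr h j|) ≤
      sqNorm h + 5 * (M ^ 2 * (T.card + 1)) +
        5 / 4 * (ν ^ 2 * (T.card * (4 * (8 / n * (1 + Real.log n) + 8 / minGap T)))) := by
  set T' : Finset ℕ := T.map Fin.valEmbedding with hT'
  have hmem : ∀ j : Fin n, (j : ℕ) ∈ T' ↔ j ∈ T := fun j => by
    exact Finset.mem_map' Fin.valEmbedding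
  have hT'n : ∀ t ∈ T', t < n := by
    intro t ht
    obtain ⟨i, _, rfl⟩ := Finset.mem_map.1 ht
    exact i.isLt
  have hbp : ∀ a ∈ insert 0 (insert n T'), a + 1 ∈ breakpoints T := by
    intro a ha
    rw [Finset.mem_insert, Finset.mem_insert] at ha
    rcases ha with rfl | rfl | ha
    · simp [breakpoints]
    · simp [breakpoints]
    · obtain ⟨i, hi, rfl⟩ := Finset.mem_map.1 ha
      simp only [breakpoints, Finset.mem_insert, Finset.mem_image]
      exact Or.inr (Or.inr ⟨i, hi, rfl⟩)
  have hsep : ∀ a ∈ insert 0 (insert n T'), ∀ b ∈ insert 0 (insert n T'), a < b →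
      a + minGap T ≤ b := by
    intro a ha b hb hab
    have := minGap_le (hbp a ha) (hbp b hb) (by omega)
    omega
  have hξ' : ∀ a b, a < b → b ≤ n →
      |∑ i ∈ Finset.Ico a b, extend ξ i| ≤ M * √((b : ℝ) - a) := by
    intro a b hab hbn
    have h1 := hξ ⟨a, by omega⟩ ⟨b - 1, by omega⟩
    have h2 : (Finset.Icc (⟨a, by omega⟩ : Fin n) ⟨b - 1, by omega⟩).map Fin.valEmbedding =
        Finset.Ico a b := by
      rw [Fin.map_valEmbedding_Icc]
      ext x
      simp only [Finset.mem_Icc, Finset.mem_Ico]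
      omega
    have h3 : ∑ i ∈ Finset.Ico a b, extend ξ i =
        ∑ i ∈ Finset.Icc (⟨a, by omega⟩ : Fin n) ⟨b - 1, by omega⟩, ξ i := by
      rw [← h2, Finset.sum_map]
      exact Finset.sum_congr rfl fun i _ => extend_val ξ i
    have h4 : ((Finset.Icc (⟨a, by omega⟩ : Fin n) ⟨b - 1, by omega⟩).card : ℝ) = (b : ℝ) - a := by
      have h5 := congrArg Finset.card h2
      rw [Finset.card_map, Nat.card_Ico] at h5
      rw [h5, Nat.cast_sub hab.le]
    rw [h3, ← h4]
    exact h1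
  have key := noise_add_penalty_le hn (one_le_minGap hn T) hT'n hsep hM hν hMν (extend ξ)
    (extend h) hξ' _ fun _ => rfl
  rw [Finset.sum_range, Finset.sum_range] at key
  simp only [← incr_eq_extend, hmem] at key
  simp only [extend_val] at key
  rw [Finset.sum_add_distrib, ← Finset.mul_sum (a := 2 * ν), hT', Finset.card_map] at key
  exact key

/-! ### The oracle inequality and the rate -/

/-- The oracle inequality, on the event where the interval sums of the noise are controlled. -/
theorem oracle_inequality {n : ℕ} (hn : 1 ≤ n) {s δ lam μ : ℝ} (hs : 0 < s) (hδ0 : 0 < δ)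
    (hδ1 : δ < 1) (hlam : lam = 2 * s * √(2 / (n : ℝ) * Real.log (n / δ)))
    (hμ1 : lam ≤ μ) (hμ2 : μ ≤ 2 * lam) {fstar ξ f : Fin n → ℝ}
    (hf : IsTVEstimator μ (fun i => fstar i + ξ i) f)
    (hξ : ∀ a b, |∑ i ∈ Finset.Icc a b, ξ i| ≤
      s * √(4 * Real.log (n / δ)) * √((Finset.Icc a b).card))
    {T : Finset (Fin n)} (hT : T.Nonempty) (g : Fin n → ℝ) :
    1 / (n : ℝ) * sqNorm (f - fstar) ≤
      1 / (n : ℝ) * sqNorm (g - fstar) + 4 * lam * tvOn Tᶜ g + remainder s δ T := by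
  have hn' : (1 : ℝ) ≤ n := by exact_mod_cast hn
  have hn0 : (0 : ℝ) < n := by linarith
  have hL : 0 < Real.log (n / δ) := Real.log_pos (by rw [lt_div_iff₀ hδ0]; linarith)
  have hlogn : 0 ≤ Real.log n := Real.log_nonneg hn'
  have hc : (1 : ℝ) ≤ T.card := by exact_mod_cast hT.card_pos
  have hΔ1 : (1 : ℝ) ≤ minGap T := by exact_mod_cast one_le_minGap hn T
  have hΔn : (minGap T : ℝ) ≤ n := by exact_mod_cast minGap_le_card hn T
  unfold remainder
  set L := Real.log (n / δ)
  set Δ : ℝ := (minGap T : ℝ)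
  set c : ℝ := (T.card : ℝ)
  have hlam0 : 0 < lam := by rw [hlam]; positivity
  have hlam2 : lam ^ 2 = 8 * s ^ 2 * L / n := by
    rw [hlam, mul_pow, Real.sq_sqrt (by positivity)]
    ring
  have hM2 : (s * √(4 * L)) ^ 2 = 4 * s ^ 2 * L := by
    rw [mul_pow, Real.sq_sqrt (by positivity)]
    ring
  set M := s * √(4 * L) with hM
  have hM0 : 0 ≤ M := by positivity
  have hμ0 : 0 < μ := by linarith
  -- This is what calibrates the penalty level: at μ = `lam` the two sides are equal.
  have hMν : M * √n ≤ √2 * (μ * n / 2) := by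
    have : M * √n ≤ √2 * (lam * n / 2) := by
      apply le_of_sq_le_sq _ (by positivity)
      rw [mul_pow M, mul_pow √2, div_pow, mul_pow lam, hM2, hlam2, Real.sq_sqrt hn0.le,
        Real.sq_sqrt (by norm_num)]
      apply le_of_eq
      field_simp
      ring
    refine this.trans ?_
    gcongr
  have h1 := hf.basic_inequality hμ0.le g
  have h2 := noise_add_penalty_le_fin hn T hM0 (by positivity) hMν ξ (f - g) hξ
  have h3 := mul_le_mul_of_nonneg_left (tv_sub_tv_le T f g) hμ0.le
  set S := ∑ j, if j ∈ T then |incr (f - g) j| else -|incr (f - g) j|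
  set V := tvOn Tᶜ g with hV
  have hV0 : 0 ≤ V := tvOn_nonneg _ _
  have h4 : μ * (2 * V) ≤ 4 * lam * V := by nlinarith
  have h5 := mul_le_mul_of_nonneg_left h2 (show 0 ≤ 1 / (n : ℝ) by positivity)
  rw [hM2] at h5
  have hν2 : (μ * n / 2) ^ 2 ≤ 8 * s ^ 2 * L * n := by
    calc (μ * n / 2) ^ 2 ≤ (2 * lam * n / 2) ^ 2 := by gcongr
      _ = lam ^ 2 * n ^ 2 := by ring
      _ = _ := by rw [hlam2]; field_simp
  have hW0 : 0 ≤ c * (4 * (8 / n * (1 + Real.log n) + 8 / Δ)) := by positivity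
  have hnΔ : 1 ≤ n / Δ := by rw [one_le_div (by positivity)]; exact hΔn
  have h6 : 1 / (n : ℝ) * (5 * (4 * s ^ 2 * L * (c + 1)) + 5 / 4 * ((μ * n / 2) ^ 2 *
      (c * (4 * (8 / n * (1 + Real.log n) + 8 / Δ))))) ≤
      4 * s ^ 2 * c * L / n * (3 + 256 * (Real.log n + n / Δ)) := by
    -- Nonemptiness of `T` enters here, through c + 1 ≤ 2c. The final comparison of constants uses
    -- n/Δ ≥ 1 to absorb the additive 90.
    calc _ ≤ 1 / (n : ℝ) * (5 * (4 * s ^ 2 * L * (c + c)) + 5 / 4 * ((8 * s ^ 2 * L * n) *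
          (c * (4 * (8 / n * (1 + Real.log n) + 8 / Δ))))) := by gcongr
      _ = 4 * s ^ 2 * c * L / n * (10 + 80 * (1 + Real.log n) + 80 * (n / Δ)) := by
          field_simp
          ring
      _ ≤ _ := by
          exact mul_le_mul_of_nonneg_left (by linarith) (by positivity)
  have h7 : 1 / (n : ℝ) * (2 * (μ * n / 2) * S) = μ * S := by field_simp
  simp only [mul_add] at h3 h5 h6 ⊢
  linarith

/-- The constant in the rate obtained under a lower bound on the spacing of the jumps. -/
noncomputable def rateConst (δ K : ℝ) : ℝ :=
  4 * (1 + Real.log (1 / δ) / Real.log 2) * (256 + (3 + 256 * K) / Real.log 2)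

theorem remainder_le_rate {n : ℕ} (hn : 2 ≤ n) {s δ K : ℝ} (hδ0 : 0 < δ)
    (hδ1 : δ < 1) {T : Finset (Fin n)} (hK : (n : ℝ) / (minGap T : ℝ) ≤ K) :
    remainder s δ T ≤ rateConst δ K * (s ^ 2 * (T.card : ℝ) * Real.log n ^ 2 / n) := by
  have hn' : (2 : ℝ) ≤ n := by exact_mod_cast hn
  have hn0 : (0 : ℝ) < n := by linarith
  have hl2 : 0 < Real.log 2 := Real.log_pos (by norm_num)
  have hln : Real.log 2 ≤ Real.log n := Real.log_le_log (by norm_num) hn'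
  have hK0 : 0 ≤ K := le_trans (by positivity) hK
  have hδ : 0 ≤ Real.log (1 / δ) := Real.log_nonneg (by rw [le_div_iff₀ hδ0]; linarith)
  have hL : Real.log (n / δ) = Real.log n + Real.log (1 / δ) := by
    rw [div_eq_mul_one_div, Real.log_mul (by positivity) (by positivity)]
  -- Since n ≥ 2, every constant can be charged to log n.
  have scale : ∀ {x : ℝ}, 0 ≤ x → x ≤ x / Real.log 2 * Real.log n := by
    intro x hx
    rw [div_mul_eq_mul_div, le_div_iff₀ hl2]
    gcongr
  have h1 : Real.log (n / δ) ≤ (1 + Real.log (1 / δ) / Real.log 2) * Real.log n := by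
    rw [hL, add_mul, one_mul]
    have := scale hδ
    linarith
  have h2 : 3 + 256 * (Real.log n + (n : ℝ) / (minGap T : ℝ)) ≤
      (256 + (3 + 256 * K) / Real.log 2) * Real.log n := by
    have := scale (x := 3 + 256 * K) (by positivity)
    rw [add_mul]
    linarith
  have h3 : 0 ≤ Real.log n := by linarith
  calc remainder s δ T ≤ 4 * s ^ 2 * (T.card : ℝ) *
        ((1 + Real.log (1 / δ) / Real.log 2) * Real.log n) / n *
        ((256 + (3 + 256 * K) / Real.log 2) * Real.log n) := by
        unfold remainder
        gcongr
    _ = _ := by rw [rateConst]; ring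

end TVDenoise

theorem proposition3p2 :
    ∃ C : ℝ → ℝ → ℝ,
      ∀ (n : ℕ) (_hn : 1 ≤ n) (s δ lam : ℝ) (_hs : 0 < s) (_hδ0 : 0 < δ) (_hδ1 : δ < 1)
        (_hlam : lam = 2 * s * Real.sqrt (2 / (n : ℝ) * Real.log (n / δ)))
        (fstar : Fin n → ℝ)
        (Ω : Type*) [MeasurableSpace Ω] (P : Measure Ω) [IsProbabilityMeasure P]
        (ξ : Fin n → Ω → ℝ)
        (_hlaw : ∀ i, HasLaw (ξ i) (gaussianReal 0 (s ^ 2).toNNReal) P)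
        (_hind : iIndepFun ξ P),
      ∃ A : Set Ω, MeasurableSet A ∧ ENNReal.ofReal (1 - 2 * δ) ≤ P A ∧
        ∀ ω ∈ A, ∀ fhat : Fin n → ℝ,
          (TVDenoise.IsTVEstimator lam (fun i => fstar i + ξ i ω) fhat ∨
            ∃ b : Fin n → ℝ,
              TVDenoise.IsLasso (TVDenoise.tvDesign n) lam (fun i => fstar i + ξ i ω) b ∧
              fhat = (TVDenoise.tvDesign n).mulVec b) →
          -- the sharp oracle inequality, simultaneously for all nonempty `T`
          (∀ T : Finset (Fin n), T.Nonempty →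
            1 / (n : ℝ) * TVDenoise.sqNorm (fhat - fstar) ≤
              (⨅ fbar : Fin n → ℝ,
                (1 / (n : ℝ) * TVDenoise.sqNorm (fbar - fstar)
                  + 4 * lam * TVDenoise.tvOn Tᶜ fbar))
              + TVDenoise.remainder s δ T) ∧
          -- its consequence for a signal with jump set `jumps fstar`
          ((TVDenoise.jumps fstar).Nonempty →
            1 / (n : ℝ) * TVDenoise.sqNorm (fhat - fstar) ≤
              TVDenoise.remainder s δ (TVDenoise.jumps fstar)) ∧
          -- the resulting rate, with a constant depending only on `δ` and on the bound `K`
          (∀ K : ℝ, 2 ≤ n → (TVDenoise.jumps fstar).Nonempty →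
            (n : ℝ) / (TVDenoise.minGap (TVDenoise.jumps fstar) : ℝ) ≤ K →
            1 / (n : ℝ) * TVDenoise.sqNorm (fhat - fstar) ≤
              C δ K * (s ^ 2 * ((TVDenoise.jumps fstar).card : ℝ) * Real.log n ^ 2 / n)) := by
  refine ⟨TVDenoise.rateConst, ?_⟩
  intro n hn s δ lam hs hδ0 hδ1 hlam fstar Ω _ P _ ξ hlaw hind
  obtain ⟨A, hAm, hAP, hA⟩ :=
    TVDenoise.exists_event_interval_sums hn hs hδ0 hδ1 P ξ hlaw hind
  refine ⟨A, hAm, hAP, fun ω hω fhat hfhat => ?_⟩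
  have hlam0 : 0 ≤ lam := by rw [hlam]; positivity
  -- Both estimators are TV estimators, at levels `lam` and `2 * lam`; the oracle inequality is
  -- uniform over this range.
  obtain ⟨μ, hμ1, hμ2, hμ⟩ : ∃ μ, lam ≤ μ ∧ μ ≤ 2 * lam ∧
      TVDenoise.IsTVEstimator μ (fun i => fstar i + ξ i ω) fhat := by
    rcases hfhat with h | ⟨b, hb, rfl⟩
    · exact ⟨lam, le_rfl, by linarith, h⟩
    · exact ⟨2 * lam, by linarith, le_rfl, hb.isTVEstimator⟩
  have oracle : ∀ T : Finset (Fin n), T.Nonempty → ∀ g : Fin n → ℝ,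
      1 / (n : ℝ) * TVDenoise.sqNorm (fhat - fstar) ≤
        1 / (n : ℝ) * TVDenoise.sqNorm (g - fstar) + 4 * lam * TVDenoise.tvOn Tᶜ g +
          TVDenoise.remainder s δ T := fun T hT g =>
    TVDenoise.oracle_inequality hn hs hδ0 hδ1 hlam hμ1 hμ2 hμ (hA ω hω) hT g
  have atJumps : (TVDenoise.jumps fstar).Nonempty →
      1 / (n : ℝ) * TVDenoise.sqNorm (fhat - fstar) ≤
        TVDenoise.remainder s δ (TVDenoise.jumps fstar) := by
    intro hJ
    have h := oracle _ hJ fstar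
    have h1 : TVDenoise.sqNorm (fstar - fstar) = 0 := by simp [TVDenoise.sqNorm]
    have h2 : TVDenoise.tvOn (TVDenoise.jumps fstar)ᶜ fstar = 0 := by
      refine Finset.sum_eq_zero fun j hj => ?_
      simpa [TVDenoise.jumps] using hj
    rwa [h1, h2, mul_zero, mul_zero, add_zero, zero_add] at h
  refine ⟨fun T hT => ?_, atJumps, fun K hn2 hJ hK => ?_⟩
  · rw [← sub_le_iff_le_add]
    exact le_ciInf fun g => sub_le_iff_le_add.2 (oracle T hT g)
  · exact (atJumps hJ).trans (TVDenoise.remainder_le_rate hn2 hδ0 hδ1 hK)
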